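/- Let $k$ be a positive integer. Let $(a_j)_{j\ge 1}$ be the unique sequence of complex numbers with $$\exp\Bigl(-\sum_{j\ge 1} a_j x^{j+1}\frac{d}{dx}\Bigr)\cdot x=\frac1k(1+x)^k-\frac1k .$$ Let $V=\coprod_{n\in\mathbb Z}V_n$ be a $\mathbb Z$-graded module for the Virasoro algebra on which the central element acts as a scalar $c\in\mathbb C$. That is, operators $L(m)\in\mathrm{End}\,V$ $(m\in\mathbb Z)$ are given with $$[L(m),L(n)]=(m-n)L(m+n)+\frac{m^3-m}{12}\,\delta_{m+n,0}\,c ,$$ and $L(0)v=nv$ for $v\in V_n$. No condition is imposed on the dimensions of the $V_n$ or on the $n$ with $V_n\ne 0$. For $v\in V_n$ put $k^{qL(0)}v=k^{qn}v$ and $z^{(p/k)L(0)}v=z^{pn/k}v$ $(p,q\in\mathbb Z)$. A product of two series in $(\mathrm{End}\,V)[[z^{1/k},z^{-1/k}]]$ is said to exist if, on each vector of $V$, each of its coefficients is a finite sum. In $(\mathrm{End}\,V)[[z^{1/k},z^{-1/k}]]$ set $$\Delta_k(z)=\exp\Bigl(\sum_{j\ge1}a_jz^{-j/k}L(j)\Bigr)k^{-L(0)}z^{(1/k-1)L(0)},\qquad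 \Delta_k(z)^{-1}=z^{-(1/k-1)L(0)}k^{L(0)}\exp\Bigl(-\sum_{j\ge1}a_jz^{-j/k}L(j)\Bigr).$$ Then these products exist, $\Delta_k(z)^{-1}$ is a two-sided inverse of $\Delta_k(z)$ (with both products existing), and $$\Delta_k(z)L(-1)-\frac1k z^{1/k-1}L(-1)\Delta_k(z)=\frac{\partial}{\partial z}\Delta_k(z),$$ $$\Delta_k(z)^{-1}L(-1)-k\,z^{-1/k+1}L(-1)\Delta_k(z)^{-1}=k\,z^{-1/k+1}\frac{\partial}{\partial z}\Delta_k(z)^{-1}.$$ In particular, all of this holds for every vertex operator algebra $(V,Y,\mathbf 1,\omega)$, with $V=\coprod_{n\in\mathbb Z}V_n$ and $L(n)$ defined by $Y(\omega,z)=\sum_{n\in\mathbb Z}L(n)z^{-n-2}$. -/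

import Mathlib

open scoped PowerSeries

noncomputable section

namespace VirasoroDelta

/-! ### The coefficients `a_j` -/

/-- The series `∑_{j ≥ 1} a_j x^(j+1)`. -/
def fieldSeries (a : ℕ+ → ℂ) : ℂ⟦X⟧ :=
  PowerSeries.mk fun m => if h : 2 ≤ m then a ⟨m - 1, by omega⟩ else 0

/-- The operator `∑_{j ≥ 1} a_j x^(j+1) d/dx` on `ℂ[[x]]`. -/
def fieldOp (a : ℕ+ → ℂ) (f : ℂ⟦X⟧) : ℂ⟦X⟧ :=
  fieldSeries a * PowerSeries.derivative ℂ f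

/-- The formal power series `exp (-∑_{j ≥ 1} a_j x^(j+1) d/dx) · x`. As the operator raises the
order of a series by at least one, the `n`-th term of the exponential series contributes to the
coefficient of `x^m` only if `n < m`, so that each coefficient is a finite sum. -/
def expFieldX (a : ℕ+ → ℂ) : ℂ⟦X⟧ :=
  PowerSeries.mk fun m => ∑ n ∈ Finset.range (m + 1),
    ((-1 : ℂ) ^ n / (n.factorial : ℂ)) * PowerSeries.coeff m ((fieldOp a)^[n] PowerSeries.X)

/-- The polynomial `(1/k) (1 + x)^k - 1/k`, as a power series. -/
def targetSeries (k : ℕ+) : ℂ⟦X⟧ :=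
  PowerSeries.C (1 / ((k : ℕ) : ℂ)) * (1 + PowerSeries.X) ^ (k : ℕ)
    - PowerSeries.C (1 / ((k : ℕ) : ℂ))

lemma X_dvd_derivative {f : ℂ⟦X⟧} {d : ℕ} (h : (PowerSeries.X : ℂ⟦X⟧) ^ (d + 1) ∣ f) :
    (PowerSeries.X : ℂ⟦X⟧) ^ d ∣ PowerSeries.derivative ℂ f := by
  rw [PowerSeries.X_pow_dvd_iff] at h ⊢
  intro m hm
  rw [PowerSeries.coeff_derivative, h (m + 1) (by omega), zero_mul]

lemma X_sq_dvd_fieldSeries (a : ℕ+ → ℂ) : (PowerSeries.X : ℂ⟦X⟧) ^ 2 ∣ fieldSeries a := by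
  rw [PowerSeries.X_pow_dvd_iff]
  intro m hm
  simp [fieldSeries, show ¬ 2 ≤ m by omega]

lemma X_sq_dvd_iterate (a : ℕ+ → ℂ) (n : ℕ) :
    (PowerSeries.X : ℂ⟦X⟧) ^ 2 ∣ (fieldOp a)^[n + 1] PowerSeries.X := by
  rw [Function.iterate_succ_apply']
  exact (X_sq_dvd_fieldSeries a).mul_right _

/-- Terms of the exponential of index at least `m` do not reach the coefficient of `x^m`. -/
lemma X_pow_dvd_iterate (a : ℕ+ → ℂ) (n : ℕ) :
    (PowerSeries.X : ℂ⟦X⟧) ^ (n + 1) ∣ (fieldOp a)^[n] PowerSeries.X := by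
  induction n with
  | zero => simp
  | succ n ih =>
    rw [Function.iterate_succ_apply']
    have h := mul_dvd_mul (X_sq_dvd_fieldSeries a) (X_dvd_derivative ih)
    rw [← pow_add] at h
    exact (pow_dvd_pow _ (by omega)).trans h

lemma fieldSeries_sub_dvd {a b : ℕ+ → ℂ} {j : ℕ} (h : ∀ i : ℕ+, (i : ℕ) < j → a i = b i) :
    (PowerSeries.X : ℂ⟦X⟧) ^ (j + 1) ∣ fieldSeries a - fieldSeries b := by
  rw [PowerSeries.X_pow_dvd_iff]
  intro m hm
  by_cases h2 : 2 ≤ m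
  · have := h ⟨m - 1, by omega⟩ (by simp; omega)
    simp [fieldSeries, h2, this]
  · simp [fieldSeries, h2]

lemma iterate_sub_dvd {a b : ℕ+ → ℂ} {j : ℕ} (h : ∀ i : ℕ+, (i : ℕ) < j → a i = b i) (n : ℕ) :
    (PowerSeries.X : ℂ⟦X⟧) ^ (j + 1) ∣
      (fieldOp a)^[n] PowerSeries.X - (fieldOp b)^[n] PowerSeries.X := by
  induction n with
  | zero => simp
  | succ n ih =>
    rw [Function.iterate_succ_apply', Function.iterate_succ_apply']
    set f := (fieldOp a)^[n] PowerSeries.X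
    set g := (fieldOp b)^[n] PowerSeries.X
    have e : fieldOp a f - fieldOp b g = fieldSeries a * PowerSeries.derivative ℂ (f - g)
        + (fieldSeries a - fieldSeries b) * PowerSeries.derivative ℂ g := by
      simp only [fieldOp, map_sub]; ring
    rw [e]
    refine dvd_add ?_ ((fieldSeries_sub_dvd h).mul_right _)
    have := mul_dvd_mul (X_sq_dvd_fieldSeries a) (X_dvd_derivative ih)
    rw [← pow_add] at this
    exact (pow_dvd_pow _ (by omega)).trans this

lemma iterate_sub_dvd_succ {a b : ℕ+ → ℂ} {j : ℕ} (h : ∀ i : ℕ+, (i : ℕ) < j → a i = b i)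
    (n : ℕ) : (PowerSeries.X : ℂ⟦X⟧) ^ (j + 2) ∣
      (fieldOp a)^[n + 2] PowerSeries.X - (fieldOp b)^[n + 2] PowerSeries.X := by
  rw [Function.iterate_succ_apply' _ (n + 1), Function.iterate_succ_apply' _ (n + 1)]
  have ih := iterate_sub_dvd h (n + 1)
  have hg := X_sq_dvd_iterate b n
  set f := (fieldOp a)^[n + 1] PowerSeries.X
  set g := (fieldOp b)^[n + 1] PowerSeries.X
  have e : fieldOp a f - fieldOp b g = fieldSeries a * PowerSeries.derivative ℂ (f - g)
      + (fieldSeries a - fieldSeries b) * PowerSeries.derivative ℂ g := by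
    simp only [fieldOp, map_sub]; ring
  rw [e]
  refine dvd_add ?_ ?_
  · have := mul_dvd_mul (X_sq_dvd_fieldSeries a) (X_dvd_derivative ih)
    rw [← pow_add] at this
    exact (pow_dvd_pow _ (by omega)).trans this
  · have := mul_dvd_mul (fieldSeries_sub_dvd h) (X_dvd_derivative (d := 1) hg)
    rw [← pow_add] at this
    exact (pow_dvd_pow _ (by omega)).trans this

lemma fieldOp_X (a : ℕ+ → ℂ) : fieldOp a PowerSeries.X = fieldSeries a := by
  simp [fieldOp]

/-- The coefficient of `x^(j+1)` depends on `a_1, …, a_j` only, and on `a_j` as `-a_j`. -/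
lemma coeff_expFieldX_sub {a b : ℕ+ → ℂ} (j : ℕ+) (h : ∀ i : ℕ+, i < j → a i = b i) :
    PowerSeries.coeff ((j : ℕ) + 1) (expFieldX a) - PowerSeries.coeff ((j : ℕ) + 1) (expFieldX b)
      = -(a j - b j) := by
  have h' : ∀ i : ℕ+, (i : ℕ) < (j : ℕ) → a i = b i := fun i hi => h i hi
  have hj : 1 ≤ (j : ℕ) := j.2
  simp only [expFieldX, PowerSeries.coeff_mk]
  rw [← Finset.sum_sub_distrib, Finset.sum_eq_single 1]
  · have hc : ∀ c : ℕ+ → ℂ, PowerSeries.coeff ((j : ℕ) + 1) (fieldSeries c) = c j := by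
      intro c
      simp only [fieldSeries, PowerSeries.coeff_mk]
      rw [dif_pos (by omega)]
      rfl
    simp [fieldOp_X, hc]
    ring
  · intro n _ hn
    rcases n with _ | _ | n
    · simp
    · exact absurd rfl hn
    · rw [← mul_sub, ← map_sub,
        PowerSeries.X_pow_dvd_iff.1 (iterate_sub_dvd_succ h' n) _ (by omega), mul_zero]
  · intro hn
    simp at hn

lemma coeff_zero_expFieldX (a : ℕ+ → ℂ) : PowerSeries.coeff 0 (expFieldX a) = 0 := by
  simp [expFieldX]

lemma coeff_one_expFieldX (a : ℕ+ → ℂ) : PowerSeries.coeff 1 (expFieldX a) = 1 := by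
  simp [expFieldX, Finset.sum_range_succ, fieldOp_X, fieldSeries]

/-- Every series `x + ⋯` is `exp (-∑ a_j x^(j+1) d/dx) · x` for a unique sequence `(a_j)`. -/
theorem existsUnique_expFieldX (g : ℂ⟦X⟧) (h0 : PowerSeries.coeff 0 g = 0)
    (h1 : PowerSeries.coeff 1 g = 1) : ∃! a : ℕ+ → ℂ, expFieldX a = g := by
  have key : ∀ a : ℕ+ → ℂ, expFieldX a = g ↔ ∀ j : ℕ+,
      PowerSeries.coeff ((j : ℕ) + 1) (expFieldX a) = PowerSeries.coeff ((j : ℕ) + 1) g := by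
    intro a
    refine ⟨fun h j => by rw [h], fun h => ?_⟩
    ext m
    rcases m with _ | _ | m
    · rw [coeff_zero_expFieldX, h0]
    · rw [zero_add, coeff_one_expFieldX, h1]
    · exact h ⟨m + 1, by omega⟩
  let F : ∀ j : ℕ+, (∀ i : ℕ+, i < j → ℂ) → ℂ := fun j r =>
    PowerSeries.coeff ((j : ℕ) + 1) (expFieldX fun i => if hi : i < j then r i hi else 0)
      - PowerSeries.coeff ((j : ℕ) + 1) g
  have wf : WellFounded fun i j : ℕ+ => i < j := wellFounded_lt
  refine ⟨wf.fix F, ?_, ?_⟩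
  · refine (key _).2 fun j => ?_
    have hfix : wf.fix F j = F j fun i _ => wf.fix F i := wf.fix_eq F j
    have := coeff_expFieldX_sub (a := wf.fix F)
      (b := fun i => if i < j then wf.fix F i else 0) j (fun i hi => by simp [hi])
    simp only [lt_irrefl, if_false, sub_zero] at this
    rw [hfix] at this
    simp only [F, dite_eq_ite] at this
    linear_combination this
  · intro b hb
    have ha : ∀ j, b j = wf.fix F j := by
      intro j
      induction j using WellFounded.induction wf with
      | _ j ih =>
        have hfix : wf.fix F j = F j fun i _ => wf.fix F i := wf.fix_eq F j
        have := coeff_expFieldX_sub (a := b)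
          (b := fun i => if i < j then wf.fix F i else 0) j (fun i hi => by simp [hi, ih i hi])
        simp only [lt_irrefl, if_false, sub_zero, (key b).1 hb j] at this
        rw [hfix]
        have hF : (F j fun i _ => wf.fix F i) =
            PowerSeries.coeff ((j : ℕ) + 1) (expFieldX fun i => if i < j then wf.fix F i else 0)
              - PowerSeries.coeff ((j : ℕ) + 1) g := by
          simp only [F, dite_eq_ite]
        rw [hF]
        linear_combination this
    exact funext ha

theorem existsUnique_target (k : ℕ+) : ∃! a : ℕ+ → ℂ, expFieldX a = targetSeries k := by
  have hk : ((k : ℕ) : ℂ) ≠ 0 := by exact_mod_cast k.ne_zero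
  refine existsUnique_expFieldX _ ?_ ?_
  · simp [targetSeries]
  · have : PowerSeries.coeff 1 ((1 + PowerSeries.X : ℂ⟦X⟧) ^ (k : ℕ)) = (k : ℕ) := by
      have e : (1 + PowerSeries.X : ℂ⟦X⟧) ^ (k : ℕ) =
          (((1 + Polynomial.X : Polynomial ℂ) ^ (k : ℕ) : Polynomial ℂ) : ℂ⟦X⟧) := by simp
      rw [e, Polynomial.coeff_coe, Polynomial.coeff_one_add_X_pow, Nat.choose_one_right]
    rw [targetSeries, map_sub, PowerSeries.coeff_C_mul, this, PowerSeries.coeff_C]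
    simp [hk]

/-- The unique sequence `(a_j)_{j ≥ 1}` of complex numbers with
`exp (-∑_{j ≥ 1} a_j x^(j+1) d/dx) · x = (1/k) (1 + x)^k - 1/k`. -/
def aCoeff (k : ℕ+) : ℕ+ → ℂ := (existsUnique_target k).choose

theorem aCoeff_spec (k : ℕ+) : expFieldX (aCoeff k) = targetSeries k :=
  (existsUnique_target k).choose_spec.1

/-! ### Formal series in `z^(1/k)` and `z^(-1/k)` with operator coefficients -/

variable {V : Type*} [AddCommGroup V] [Module ℂ V]

/-- `(End V)[[z^(1/k), z^(-1/k)]]`: the value at `m : ℤ` is the coefficient of `z^(m/k)`. -/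
abbrev EndSeries (V : Type*) [AddCommGroup V] [Module ℂ V] := ℤ → Module.End ℂ V

namespace EndSeries

/-- The constant series `1`. -/
def one : EndSeries V := fun m => if m = 0 then LinearMap.id else 0

/-- The product `T A(z)` with a constant operator `T` on the left. -/
def opMul (T : Module.End ℂ V) (A : EndSeries V) : EndSeries V := fun m => T ∘ₗ A m

/-- The product `A(z) T` with a constant operator `T` on the right. -/
def mulOp (A : EndSeries V) (T : Module.End ℂ V) : EndSeries V := fun m => A m ∘ₗ T

/-- The product `z^(p/k) A(z)`. -/
def zMul (p : ℤ) (A : EndSeries V) : EndSeries V := fun m => A (m - p)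

/-- The derivative `∂A/∂z`, where `∂/∂z z^(m/k) = (m/k) z^(m/k - 1)`. -/
def zDeriv (k : ℕ+) (A : EndSeries V) : EndSeries V :=
  fun m => (((m + (k : ℕ) : ℤ) : ℂ) / ((k : ℕ) : ℂ)) • A (m + (k : ℕ))

/-- The product `A(z) B(z)` exists: on each vector, each of its coefficients is a finite sum. -/
def ProdExists (A B : EndSeries V) : Prop :=
  ∀ (m : ℤ) (v : V), (Function.support fun i : ℤ => A i (B (m - i) v)).Finite

open Classical in
/-- The product `A(z) B(z)`, with coefficients `v ↦ ∑_i A_i (B_(m-i) v)` where it exists, and the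
default value `0` where it does not. -/
def prod (A B : EndSeries V) : EndSeries V := fun m =>
  if h : ProdExists A B then
    { toFun := fun v => ∑ᶠ i : ℤ, A i (B (m - i) v)
      map_add' := fun v w => by
        simp only [map_add]
        exact finsum_add_distrib (h m v) (h m w)
      map_smul' := fun c v => by
        simp only [map_smul, RingHom.id_apply]
        exact (smul_finsum' c (h m v)).symm }
  else 0

/-- `B(z)` is a two-sided inverse of `A(z)`; in particular both products exist. -/
def IsInverse (A B : EndSeries V) : Prop :=
  ProdExists A B ∧ prod A B = one ∧ ProdExists B A ∧ prod B A = one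

end EndSeries

/-! ### Virasoro modules and the operator `Δ_k(z)` -/

/-- The operators `L(m)`, `m ∈ ℤ`, on `V = ⨁ V_n` make `V` a module for the Virasoro algebra, of
central charge `c`, such that `L(0) v = n v` for `v ∈ V_n`. -/
structure IsGradedVirasoroModule (𝒱 : ℤ → Submodule ℂ V) [DirectSum.Decomposition 𝒱]
    (L : ℤ → Module.End ℂ V) (c : ℂ) : Prop where
  commutator : ∀ m n : ℤ, L m ∘ₗ L n - L n ∘ₗ L m = ((m - n : ℤ) : ℂ) • L (m + n) +
    (if m + n = 0 then ((m ^ 3 - m : ℤ) : ℂ) / 12 * c else 0) • LinearMap.id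
  weight : ∀ n : ℤ, ∀ v ∈ 𝒱 n, L 0 v = (n : ℂ) • v

/-- The operator with `v ↦ f(n) v` for `v ∈ V_n`. -/
def weightScale (𝒱 : ℤ → Submodule ℂ V) [DirectSum.Decomposition 𝒱] (f : ℤ → ℂ) :
    Module.End ℂ V :=
  DirectSum.toModule ℂ ℤ V (fun n => f n • (𝒱 n).subtype) ∘ₗ
    (DirectSum.decomposeLinearEquiv 𝒱).toLinearMap

/-- The operator `k^(q L(0))`: `v ↦ k^(q n) v` for `v ∈ V_n`. -/
def kPow (𝒱 : ℤ → Submodule ℂ V) [DirectSum.Decomposition 𝒱] (k : ℕ+) (q : ℤ) :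
    Module.End ℂ V :=
  weightScale 𝒱 fun n => ((k : ℕ) : ℂ) ^ (q * n)

/-- The series `z^((p/k) L(0))`: `v ↦ z^(p n/k) v` for `v ∈ V_n`. -/
def zPow (𝒱 : ℤ → Submodule ℂ V) [DirectSum.Decomposition 𝒱] (p : ℤ) : EndSeries V :=
  fun m => weightScale 𝒱 fun n => if p * n = m then 1 else 0

/-- `∑_{j ≥ 1} a_j s^j L(j)` in `(End V)[[s]]`. -/
def virSeries (a : ℕ+ → ℂ) (L : ℤ → Module.End ℂ V) : PowerSeries (Module.End ℂ V) :=
  PowerSeries.mk fun j => if h : 0 < j then a ⟨j, h⟩ • L j else 0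

/-- The exponential `∑_n S^n / n!` of a power series `S` over `End V` without constant term; `S^n`
has no terms of degree less than `n`, so that each coefficient is a finite sum. -/
def formalExp (S : PowerSeries (Module.End ℂ V)) : PowerSeries (Module.End ℂ V) :=
  PowerSeries.mk fun N => ∑ n ∈ Finset.range (N + 1),
    ((n.factorial : ℂ)⁻¹) • PowerSeries.coeff N (S ^ n)

/-- The substitution `s = z^(-1/k)` in a power series. -/
def atInvRoot (S : PowerSeries (Module.End ℂ V)) : EndSeries V :=
  fun m => if m ≤ 0 then PowerSeries.coeff (-m).toNat S else 0

/-- `exp (∑_{j ≥ 1} a_j z^(-j/k) L(j))`. -/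
def expL (k : ℕ+) (L : ℤ → Module.End ℂ V) : EndSeries V :=
  atInvRoot (formalExp (virSeries (aCoeff k) L))

/-- `exp (-∑_{j ≥ 1} a_j z^(-j/k) L(j))`. -/
def expNegL (k : ℕ+) (L : ℤ → Module.End ℂ V) : EndSeries V :=
  atInvRoot (formalExp (-virSeries (aCoeff k) L))

/-- `k^(-L(0)) z^((1/k - 1) L(0))`. -/
def scaling (𝒱 : ℤ → Submodule ℂ V) [DirectSum.Decomposition 𝒱] (k : ℕ+) : EndSeries V :=
  EndSeries.opMul (kPow 𝒱 k (-1)) (zPow 𝒱 (1 - (k : ℕ)))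

/-- `z^(-(1/k - 1) L(0)) k^(L(0))`. -/
def scalingInv (𝒱 : ℤ → Submodule ℂ V) [DirectSum.Decomposition 𝒱] (k : ℕ+) : EndSeries V :=
  EndSeries.mulOp (zPow 𝒱 (-(1 - (k : ℕ)))) (kPow 𝒱 k 1)

/-- `Δ_k(z) = exp (∑_{j ≥ 1} a_j z^(-j/k) L(j)) k^(-L(0)) z^((1/k - 1) L(0))`. -/
def Delta (𝒱 : ℤ → Submodule ℂ V) [DirectSum.Decomposition 𝒱] (k : ℕ+)
    (L : ℤ → Module.End ℂ V) : EndSeries V :=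
  EndSeries.prod (expL k L) (scaling 𝒱 k)

/-- `Δ_k(z)⁻¹ = z^(-(1/k - 1) L(0)) k^(L(0)) exp (-∑_{j ≥ 1} a_j z^(-j/k) L(j))`. -/
def DeltaInv (𝒱 : ℤ → Submodule ℂ V) [DirectSum.Decomposition 𝒱] (k : ℕ+)
    (L : ℤ → Module.End ℂ V) : EndSeries V :=
  EndSeries.prod (scalingInv 𝒱 k) (expNegL k L)

/-! ### Vertex operator algebras -/

open VertexOperator in
/-- A vertex operator algebra `(V, Y, 𝟏, ω)` of central charge `c` on the graded space `V = ⨁ V_n`.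
The coefficient of `z^(-n-1)` in `Y(u, z)` is written `(Y u)[[n]]`. -/
structure VertexOperatorAlgebra (𝒱 : ℤ → Submodule ℂ V) [DirectSum.Decomposition 𝒱] where
  /-- the state-field correspondence; its values are lower truncated by their type -/
  Y : V →ₗ[ℂ] VertexOperator ℂ V
  /-- the vacuum vector -/
  vac : V
  /-- the conformal vector -/
  conf : V
  /-- the central charge -/
  c : ℂ
  finite_dim : ∀ n : ℤ, Module.Finite ℂ (𝒱 n)
  bounded_below : ∃ N : ℤ, ∀ n : ℤ, n < N → 𝒱 n = ⊥
  vac_mem : vac ∈ 𝒱 0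
  conf_mem : conf ∈ 𝒱 2
  vac_field : ∀ n : ℤ, (Y vac)[[n]] = if n = -1 then LinearMap.id else 0
  creation : ∀ (u : V) (n : ℤ), 0 ≤ n → ((Y u)[[n]]) vac = 0
  creation_limit : ∀ u : V, ((Y u)[[-1]]) vac = u
  /-- the Jacobi identity, in components -/
  jacobi : ∀ (u v w : V) (l m n : ℤ),
    ∑ᶠ i : ℕ, Ring.choose m i • ((Y (((Y u)[[l + i]]) v))[[m + n - i]]) w =
      ∑ᶠ i : ℕ, ((-1 : ℤ) ^ i * Ring.choose l i) •
        (((Y u)[[m + l - i]]) (((Y v)[[n + i]]) w) -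
          (l.negOnePow : ℤ) • ((Y v)[[n + l - i]]) (((Y u)[[m + i]]) w))
  /-- the Virasoro relations for `L(n) = ω_(n+1)`, and `L(0) v = n v` for `v ∈ V_n` -/
  virasoro : IsGradedVirasoroModule 𝒱 (fun n => (Y conf)[[n + 1]]) c
  /-- `Y(L(-1) u, z) = d/dz Y(u, z)` -/
  derivative : ∀ (u : V) (n : ℤ),
    (Y (((Y conf)[[(-1) + 1]]) u))[[n]] = (-(n : ℂ)) • (Y u)[[n - 1]]

/-- The operator `L(n)` of a vertex operator algebra, where `Y(ω, z) = ∑ L(n) z^(-n-2)`. -/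
def VertexOperatorAlgebra.L {𝒱 : ℤ → Submodule ℂ V} [DirectSum.Decomposition 𝒱]
    (A : VertexOperatorAlgebra 𝒱) (n : ℤ) : Module.End ℂ V :=
  (A.Y A.conf).ncoeff (n + 1)

end VirasoroDelta

end

/-!
Why the identities hold. Write `S(s) = ∑_{j ≥ 1} a_j s^j L(j)` and `E(s) = exp S(s)`, so that
`Δ_k(z) = E(z^(-1/k)) k^(-L(0)) z^((1/k - 1) L(0))`. The operators `L(n)` with `n ≥ -1` satisfy the
relations of the vector fields `-x^(n+1) d/dx`, without central term (`modeSeries_commutator`).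
A vector field `-f d/dx` is represented by the series `modeSeries L f = ∑ f_n s^n L(n - 1)`, and
conjugation by `E(s)` acts on these series through the adjoint action of
`exp (-∑ a_j x^(j+1) d/dx)` on vector fields (`formalExp_mul_modeSeries`).

That exponential is substitution of `g = ((1 + x)^k - 1) / k` for `x`. As `1 + k g = (1 + x)^k` and
`g' = (1 + x)^(k-1)`, it takes `(1 + k x) d/dx` to `(1 + x) d/dx` (`expAd_one_add`). In the module
this reads `E(s) (L(-1) + k s L(0)) = (L(-1) + s L(0)) E(s)` (`expPos_intertwines`). The coefficient
of `s^N` in `E(s)` lowers weights by `N`, so that `s E'(s) = E(s) L(0) - L(0) E(s)`; this turns the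
relation into the differential equation for `Δ_k(z)`, and the inverse relation
(`expNeg_intertwines`) into the one for `Δ_k(z)⁻¹`.

All statements about exponentials come from two facts: the Leibniz rule for divided powers with
respect to a bilinear map (`divPow_bilin`), and the Cauchy product of `X`-adically summable families
(`seriesSum_mul`). On a homogeneous vector each coefficient of `Δ_k(z)` and of `Δ_k(z)⁻¹` is a single
term (`Delta_apply`, `DeltaInv_apply`), which gives the existence of all products.
-/

noncomputable section

namespace VirasoroDelta

open Finset.HasAntidiagonal (antidiagonal mem_antidiagonal)

/-! ### Divided powers and sums of formal series -/

section Exponentials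

variable {M N P : Type*} [AddCommGroup M] [Module ℂ M] [AddCommGroup N] [Module ℂ N]
  [AddCommGroup P] [Module ℂ P]

/-- The divided power `dⁿ / n!` of an endomorphism `d`. -/
def divPow (d : Module.End ℂ M) (n : ℕ) : Module.End ℂ M := (n.factorial : ℂ)⁻¹ • d ^ n

lemma divPow_zero (d : Module.End ℂ M) : divPow d 0 = 1 := by simp [divPow]

lemma divPow_succ_smul (d : Module.End ℂ M) (n : ℕ) :
    ((n + 1 : ℕ) : ℂ) • divPow d (n + 1) = d * divPow d n := by
  have h : ((n + 1 : ℕ) : ℂ) ≠ 0 := Nat.cast_ne_zero.2 n.succ_ne_zero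
  rw [divPow, divPow, smul_smul, Nat.factorial_succ, Nat.cast_mul, mul_inv, ← mul_assoc,
    mul_inv_cancel₀ h, one_mul, pow_succ', mul_smul_comm]

/-- The higher Leibniz rule, in terms of divided powers. -/
lemma divPow_bilin (B : M →ₗ[ℂ] N →ₗ[ℂ] P) (d : Module.End ℂ P) (d₁ : Module.End ℂ M)
    (d₂ : Module.End ℂ N) (h : ∀ u v, d (B u v) = B (d₁ u) v + B u (d₂ v)) (n : ℕ) (u : M)
    (v : N) : divPow d n (B u v) =
      ∑ p ∈ antidiagonal n, B (divPow d₁ p.1 u) (divPow d₂ p.2 v) := by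
  induction n with
  | zero => simp [divPow_zero]
  | succ n ih =>
    have hn : ((n + 1 : ℕ) : ℂ) ≠ 0 := Nat.cast_ne_zero.2 n.succ_ne_zero
    refine smul_right_injective _ hn ?_
    -- weighted by `n + 1 = p.1 + p.2`, the sum splits into the two shifted sums
    have key : ((n + 1 : ℕ) : ℂ) • ∑ p ∈ antidiagonal (n + 1),
          B (divPow d₁ p.1 u) (divPow d₂ p.2 v) =
        ∑ p ∈ antidiagonal (n + 1), B ((p.1 : ℂ) • divPow d₁ p.1 u) (divPow d₂ p.2 v) +
        ∑ p ∈ antidiagonal (n + 1), B (divPow d₁ p.1 u) ((p.2 : ℂ) • divPow d₂ p.2 v) := by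
      rw [Finset.smul_sum, ← Finset.sum_add_distrib]
      refine Finset.sum_congr rfl fun p hp => ?_
      rw [← mem_antidiagonal.1 hp]
      simp [add_smul]
    have hs₁ : ∀ i : ℕ, ((i + 1 : ℕ) : ℂ) • divPow d₁ (i + 1) u = d₁ (divPow d₁ i u) :=
      fun i => congrArg (· u) (divPow_succ_smul d₁ i)
    have hs₂ : ∀ i : ℕ, ((i + 1 : ℕ) : ℂ) • divPow d₂ (i + 1) v = d₂ (divPow d₂ i v) :=
      fun i => congrArg (· v) (divPow_succ_smul d₂ i)
    have hs : ((n + 1 : ℕ) : ℂ) • divPow d (n + 1) (B u v) = d (divPow d n (B u v)) :=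
      congrArg (· (B u v)) (divPow_succ_smul d n)
    simp only
    rw [key, hs, ih, Finset.Nat.sum_antidiagonal_succ
      (f := fun p : ℕ × ℕ => B ((p.1 : ℂ) • divPow d₁ p.1 u) (divPow d₂ p.2 v)),
      Finset.Nat.sum_antidiagonal_succ'
      (f := fun p : ℕ × ℕ => B (divPow d₁ p.1 u) ((p.2 : ℂ) • divPow d₂ p.2 v))]
    simp only [hs₁, hs₂, Nat.cast_zero, zero_smul, map_zero, LinearMap.zero_apply, zero_add]
    rw [map_sum, ← Finset.sum_add_distrib]
    exact Finset.sum_congr rfl fun p _ => h _ _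

variable {R : Type*} [Ring R]

/-- A sequence of power series with `A n` divisible by `X ^ n`, stated through coefficients as the
coefficient ring need not be commutative. It implies `X`-adic summability. -/
def AdicSummable (A : ℕ → R⟦X⟧) : Prop := ∀ n m, m < n → PowerSeries.coeff m (A n) = 0

/-- The sum `∑ A n` of an `AdicSummable` sequence; only the terms with `n ≤ m` contribute to the
coefficient of `X ^ m`, and the definition keeps just these. -/
def seriesSum (A : ℕ → R⟦X⟧) : R⟦X⟧ :=
  PowerSeries.mk fun m => ∑ n ∈ Finset.range (m + 1), PowerSeries.coeff m (A n)

lemma coeff_seriesSum {A : ℕ → R⟦X⟧} (hA : AdicSummable A) {m K : ℕ} (h : m < K) :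
    PowerSeries.coeff m (seriesSum A) = ∑ n ∈ Finset.range K, PowerSeries.coeff m (A n) := by
  rw [seriesSum, PowerSeries.coeff_mk]
  refine Finset.sum_subset (Finset.range_mono h) fun n _ hn => hA n m ?_
  simpa [Nat.lt_succ_iff] using hn

/-- The Cauchy product of two sums. -/
lemma seriesSum_mul {A B : ℕ → R⟦X⟧} (hA : AdicSummable A) (hB : AdicSummable B) :
    seriesSum A * seriesSum B =
      seriesSum fun n => ∑ p ∈ antidiagonal n, A p.1 * B p.2 := by
  ext m
  have h1 : PowerSeries.coeff m (seriesSum A * seriesSum B) =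
      ∑ i ∈ Finset.range (m + 1), ∑ j ∈ Finset.range (m + 1),
        PowerSeries.coeff m (A i * B j) := by
    simp only [PowerSeries.coeff_mul]
    have h2 : ∀ p ∈ antidiagonal m,
        PowerSeries.coeff p.1 (seriesSum A) * PowerSeries.coeff p.2 (seriesSum B) =
          ∑ i ∈ Finset.range (m + 1), ∑ j ∈ Finset.range (m + 1),
            PowerSeries.coeff p.1 (A i) * PowerSeries.coeff p.2 (B j) := by
      intro p hp
      have := mem_antidiagonal.1 hp
      rw [coeff_seriesSum hA (K := m + 1) (by omega), coeff_seriesSum hB (K := m + 1) (by omega),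
        Finset.sum_mul_sum]
    rw [Finset.sum_congr rfl h2]
    rw [Finset.sum_comm]
    exact Finset.sum_congr rfl fun i _ => Finset.sum_comm
  rw [h1, seriesSum, PowerSeries.coeff_mk]
  simp only [map_sum]
  rw [← Finset.sum_product', Finset.sum_sigma']
  -- the pairs `(i, j)` with `i + j > m` do not contribute
  symm
  refine Finset.sum_of_injOn (fun x => (x.2.1, x.2.2)) ?_ ?_ ?_ ?_
  · rintro ⟨n, a, b⟩ hx ⟨n', a', b'⟩ hy hxy
    simp only [Finset.coe_sigma, Set.mem_sigma_iff, Finset.mem_coe, Finset.mem_range,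
      mem_antidiagonal, Prod.mk.injEq] at hx hy hxy
    obtain ⟨rfl, rfl⟩ := hxy
    obtain rfl : n = n' := by omega
    rfl
  · rintro ⟨n, a, b⟩ hx
    simp only [Finset.coe_sigma, Set.mem_sigma_iff, Finset.mem_coe, Finset.mem_range,
      mem_antidiagonal, Finset.coe_product, Set.mem_prod] at hx ⊢
    omega
  · rintro ⟨a, b⟩ hx hx'
    have hab : m < a + b := by
      by_contra hcon
      refine hx' ⟨⟨a + b, a, b⟩, ?_, rfl⟩
      simp
      omega
    simp only [PowerSeries.coeff_mul]
    refine Finset.sum_eq_zero fun p hp => ?_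
    have := mem_antidiagonal.1 hp
    by_cases h : p.1 < a
    · rw [hA a _ h, zero_mul]
    · rw [hB b _ (by omega), mul_zero]
  · intro x _
    rfl

end Exponentials

/-! ### Formal vector fields -/

section VectorFields

/-- The adjoint action of a vector field: with `W = adField f`, one has
`[-f d/dx, g d/dx] = (W g) d/dx`. -/
def adField (f : ℂ⟦X⟧) : Module.End ℂ ℂ⟦X⟧ where
  toFun g := PowerSeries.derivative ℂ f * g - f * PowerSeries.derivative ℂ g
  map_add' g h := by simp only [map_add]; ring
  map_smul' c g := by
    simp only [Derivation.map_smul, mul_smul_comm, smul_sub, RingHom.id_apply]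

/-- The operator `-f d/dx` on power series. -/
def negField (f : ℂ⟦X⟧) : Module.End ℂ ℂ⟦X⟧ where
  toFun g := -(f * PowerSeries.derivative ℂ g)
  map_add' g h := by simp only [map_add]; ring
  map_smul' c g := by
    simp only [Derivation.map_smul, mul_smul_comm, smul_neg, RingHom.id_apply]

lemma X_pow_dvd_adField {f g : ℂ⟦X⟧} (hf : (PowerSeries.X : ℂ⟦X⟧) ^ 2 ∣ f) {n : ℕ}
    (hg : (PowerSeries.X : ℂ⟦X⟧) ^ n ∣ g) : (PowerSeries.X : ℂ⟦X⟧) ^ (n + 1) ∣ adField f g := by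
  refine dvd_sub ?_ ?_
  · have := mul_dvd_mul (X_dvd_derivative (d := 1) hf) hg
    rwa [← pow_add, add_comm] at this
  · cases n with
    | zero => exact ((pow_dvd_pow _ (by omega)).trans hf).mul_right _
    | succ n =>
      have := mul_dvd_mul hf (X_dvd_derivative hg)
      rwa [← pow_add, show 2 + n = n + 1 + 1 by omega] at this

lemma adicSummable_adField {f : ℂ⟦X⟧} (hf : (PowerSeries.X : ℂ⟦X⟧) ^ 2 ∣ f) (g : ℂ⟦X⟧) :
    AdicSummable fun n => divPow (adField f) n g := by
  intro n
  rw [← PowerSeries.X_pow_dvd_iff]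
  have h : (PowerSeries.X : ℂ⟦X⟧) ^ n ∣ (adField f ^ n) g := by
    induction n with
    | zero => simp
    | succ n ih =>
      rw [pow_succ' (adField f)]
      exact X_pow_dvd_adField hf ih
  simp only [divPow, LinearMap.smul_apply, PowerSeries.smul_eq_C_mul]
  exact h.mul_left _

/-- The series `exp (ad (-f d/dx)) g`. -/
def expAd (f g : ℂ⟦X⟧) : ℂ⟦X⟧ := seriesSum fun n => divPow (adField f) n g

lemma divPow_negField_X (a : ℕ+ → ℂ) (n : ℕ) :
    divPow (negField (fieldSeries a)) n PowerSeries.X =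
      ((-1 : ℂ) ^ n / (n.factorial : ℂ)) • (fieldOp a)^[n] PowerSeries.X := by
  have h : (negField (fieldSeries a) ^ n) PowerSeries.X =
      (-1 : ℂ) ^ n • (fieldOp a)^[n] PowerSeries.X := by
    induction n with
    | zero => simp
    | succ n ih =>
      rw [pow_succ', Module.End.mul_apply, ih, map_smul, Function.iterate_succ_apply', pow_succ,
        mul_smul, neg_one_smul]
      rfl
  rw [divPow, LinearMap.smul_apply, h, smul_smul, div_eq_inv_mul]

lemma expFieldX_eq_seriesSum (a : ℕ+ → ℂ) :
    expFieldX a = seriesSum fun n => divPow (negField (fieldSeries a)) n PowerSeries.X := by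
  ext m
  simp [expFieldX, seriesSum, divPow_negField_X]

lemma X_pow_dvd_divPow_negField (a : ℕ+ → ℂ) (n : ℕ) :
    (PowerSeries.X : ℂ⟦X⟧) ^ (n + 1) ∣ divPow (negField (fieldSeries a)) n PowerSeries.X := by
  rw [divPow_negField_X, PowerSeries.smul_eq_C_mul]
  exact (X_pow_dvd_iterate a n).mul_left _

lemma derivative_seriesSum {A : ℕ → ℂ⟦X⟧} (hA : ∀ n, (PowerSeries.X : ℂ⟦X⟧) ^ (n + 1) ∣ A n) :
    PowerSeries.derivative ℂ (seriesSum A) =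
      seriesSum fun n => PowerSeries.derivative ℂ (A n) := by
  ext m
  have h : AdicSummable A := fun n m hm => PowerSeries.X_pow_dvd_iff.1 (hA n) m (by omega)
  have h0 : PowerSeries.coeff (m + 1) (A (m + 1)) = 0 :=
    PowerSeries.X_pow_dvd_iff.1 (hA (m + 1)) _ (by omega)
  rw [PowerSeries.coeff_derivative, coeff_seriesSum h (K := m + 1 + 1) (by omega),
    Finset.sum_range_succ, h0, add_zero, seriesSum, PowerSeries.coeff_mk, Finset.sum_mul]
  exact Finset.sum_congr rfl fun n _ => (PowerSeries.coeff_derivative _ _).symm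

/-- With `P = exp (-f d/dx)`, the identity `P ∘ (g d/dx) = (exp (ad (-f d/dx)) g) d/dx ∘ P` applied
to `x`. -/
lemma seriesSum_negField (a : ℕ+ → ℂ) (g : ℂ⟦X⟧) :
    (seriesSum fun n => divPow (negField (fieldSeries a)) n g) =
      expAd (fieldSeries a) g * PowerSeries.derivative ℂ (expFieldX a) := by
  rw [expFieldX_eq_seriesSum, derivative_seriesSum (X_pow_dvd_divPow_negField a), expAd,
    seriesSum_mul (adicSummable_adField (X_sq_dvd_fieldSeries a) g)]
  · congr 1
    ext1 n
    have h := divPow_bilin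
      ((LinearMap.mul ℂ ℂ⟦X⟧).compl₂ (PowerSeries.derivative ℂ : ℂ⟦X⟧ →ₗ[ℂ] ℂ⟦X⟧))
      (negField (fieldSeries a)) (adField (fieldSeries a)) (negField (fieldSeries a)) (by
        intro u v
        simp only [LinearMap.compl₂_apply, LinearMap.mul_apply', negField, adField,
          LinearMap.coe_mk, AddHom.coe_mk, Derivation.coeFn_coe, Derivation.leibniz, map_neg,
          smul_eq_mul]
        ring) n g PowerSeries.X
    simpa using h
  · intro n m hm
    exact PowerSeries.X_pow_dvd_iff.1 (X_dvd_derivative (X_pow_dvd_divPow_negField a n)) m hm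

lemma derivative_targetSeries (k : ℕ+) :
    PowerSeries.derivative ℂ (targetSeries k) = (1 + PowerSeries.X) ^ ((k : ℕ) - 1) := by
  have hk : ((k : ℕ) : ℂ) ≠ 0 := by exact_mod_cast k.ne_zero
  have h : PowerSeries.derivative ℂ ((1 + PowerSeries.X : ℂ⟦X⟧) ^ (k : ℕ)) =
      PowerSeries.C ((k : ℕ) : ℂ) * (1 + PowerSeries.X) ^ ((k : ℕ) - 1) := by
    rw [Derivation.leibniz_pow]
    simp
  rw [targetSeries, map_sub, ← PowerSeries.smul_eq_C_mul, Derivation.map_smul, h,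
    PowerSeries.smul_eq_C_mul, ← mul_assoc, ← map_mul, one_div, inv_mul_cancel₀ hk]
  simp

/-- The adjoint action of `exp (-∑ a_j x^(j+1) d/dx)`, the substitution of
`((1 + x)^k - 1) / k` for `x`, takes `(1 + k x) d/dx` to `(1 + x) d/dx`. -/
lemma expAd_one_add (k : ℕ+) :
    expAd (fieldSeries (aCoeff k)) (1 + PowerSeries.C ((k : ℕ) : ℂ) * PowerSeries.X) =
      1 + PowerSeries.X := by
  have hk : ((k : ℕ) : ℂ) ≠ 0 := by exact_mod_cast k.ne_zero
  have h := seriesSum_negField (aCoeff k) (1 + PowerSeries.C ((k : ℕ) : ℂ) * PowerSeries.X)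
  have h1 : ∀ n, divPow (negField (fieldSeries (aCoeff k))) n (1 : ℂ⟦X⟧) =
      if n = 0 then 1 else 0 := by
    intro n
    cases n with
    | zero => simp [divPow]
    | succ n => simp [divPow, pow_succ, negField]
  have hl : (seriesSum fun n => divPow (negField (fieldSeries (aCoeff k))) n
      (1 + PowerSeries.C ((k : ℕ) : ℂ) * PowerSeries.X)) =
      1 + PowerSeries.C ((k : ℕ) : ℂ) * expFieldX (aCoeff k) := by
    rw [expFieldX_eq_seriesSum]
    ext m
    simp only [← PowerSeries.smul_eq_C_mul, map_add, map_smul, h1, seriesSum,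
      PowerSeries.coeff_mk, Finset.sum_add_distrib, ← Finset.smul_sum]
    congr 1
    rw [Finset.sum_eq_single 0] <;> simp +contextual
  rw [hl, aCoeff_spec, derivative_targetSeries] at h
  have h2 : (1 + PowerSeries.C ((k : ℕ) : ℂ) * targetSeries k : ℂ⟦X⟧) =
      (1 + PowerSeries.X) * (1 + PowerSeries.X) ^ ((k : ℕ) - 1) := by
    rw [← pow_succ', Nat.sub_add_cancel k.pos, targetSeries, mul_sub, ← mul_assoc, ← map_mul,
      mul_one_div_cancel hk]
    simp
  rw [h2] at h
  have hne : (1 + PowerSeries.X : ℂ⟦X⟧) ≠ 0 := fun h0 => by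
    simpa using congrArg (PowerSeries.coeff 0) h0
  exact (mul_right_cancel₀ (pow_ne_zero _ hne) h).symm

end VectorFields

/-! ### Vector fields acting on a Virasoro module -/

section Modes

variable {V : Type*} [AddCommGroup V] [Module ℂ V]

/-- The operator `∑_{n ≥ 0} f_n s^n L(n - 1)` attached to `f = ∑ f_n x^n`; it represents the
vector field `-f d/dx`, graded by powers of `s`. -/
def modeSeries (L : ℤ → Module.End ℂ V) : ℂ⟦X⟧ →ₗ[ℂ] PowerSeries (Module.End ℂ V) where
  toFun f := PowerSeries.mk fun n => PowerSeries.coeff n f • L ((n : ℤ) - 1)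
  map_add' f g := by ext1 n; simp [add_smul]
  map_smul' c f := by ext1 n; simp [mul_smul]

lemma coeff_modeSeries (L : ℤ → Module.End ℂ V) (f : ℂ⟦X⟧) (n : ℕ) :
    PowerSeries.coeff n (modeSeries L f) = PowerSeries.coeff n f • L ((n : ℤ) - 1) := by
  simp [modeSeries]

lemma X_mul_virSeries (a : ℕ+ → ℂ) (L : ℤ → Module.End ℂ V) :
    PowerSeries.X * virSeries a L = modeSeries L (fieldSeries a) := by
  ext1 n
  rw [coeff_modeSeries]
  rcases n with _ | _ | n
  · simp [fieldSeries]
  · simp [fieldSeries, PowerSeries.coeff_succ_X_mul, virSeries]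
  · rw [PowerSeries.coeff_succ_X_mul, virSeries, PowerSeries.coeff_mk, fieldSeries,
      PowerSeries.coeff_mk, dif_pos (by omega), dif_pos (by omega)]
    congr 2
    push_cast
    ring

/-- The modes `L(n)` with `n ≥ -1` commute as in the Witt algebra: no central term occurs. -/
lemma modeSeries_commutator {𝒱 : ℤ → Submodule ℂ V} [DirectSum.Decomposition 𝒱]
    {L : ℤ → Module.End ℂ V} {c : ℂ} (h : IsGradedVirasoroModule 𝒱 L c) (f g : ℂ⟦X⟧) :
    modeSeries L f * modeSeries L g - modeSeries L g * modeSeries L f =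
      PowerSeries.X * modeSeries L (adField f g) := by
  have hcomm : ∀ i j : ℕ, L ((i : ℤ) - 1) * L ((j : ℤ) - 1) - L ((j : ℤ) - 1) * L ((i : ℤ) - 1) =
      ((i : ℂ) - (j : ℂ)) • L (((i + j : ℕ) : ℤ) - 2) := by
    intro i j
    have := h.commutator ((i : ℤ) - 1) ((j : ℤ) - 1)
    have hz : (if ((i : ℤ) - 1) + ((j : ℤ) - 1) = 0 then
        (((((i : ℤ) - 1) ^ 3 - ((i : ℤ) - 1) : ℤ) : ℂ) / 12 * c) else 0) = 0 := by
      split_ifs with h0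
      · have hi : i ≤ 2 := by omega
        interval_cases i <;> norm_num
      · rfl
    rw [hz, zero_smul, add_zero] at this
    refine Eq.trans this ?_
    congr 1
    · push_cast; ring
    · congr 1; push_cast; ring
  have hswap : ∀ N : ℕ, PowerSeries.coeff N (modeSeries L g * modeSeries L f) =
      ∑ p ∈ antidiagonal N, PowerSeries.coeff p.2 (modeSeries L g) *
        PowerSeries.coeff p.1 (modeSeries L f) := by
    intro N
    rw [PowerSeries.coeff_mul, ← Finset.Nat.sum_antidiagonal_swap]
    rfl
  have hsum : ∀ N : ℕ, PowerSeries.coeff N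
      (modeSeries L f * modeSeries L g - modeSeries L g * modeSeries L f) =
      (∑ p ∈ antidiagonal N, ((p.1 : ℂ) - (p.2 : ℂ)) *
        (PowerSeries.coeff p.1 f * PowerSeries.coeff p.2 g)) • L ((N : ℤ) - 2) := by
    intro N
    rw [map_sub, PowerSeries.coeff_mul, hswap, ← Finset.sum_sub_distrib, Finset.sum_smul]
    refine Finset.sum_congr rfl fun p hp => ?_
    rw [← mem_antidiagonal.1 hp, mul_smul, smul_comm, ← hcomm, coeff_modeSeries, coeff_modeSeries,
      smul_mul_smul_comm, smul_mul_smul_comm, smul_sub, mul_comm (PowerSeries.coeff p.2 g)]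
  have hX : ∀ (u : ℂ⟦X⟧) (n : ℕ), PowerSeries.coeff n
      (PowerSeries.X * PowerSeries.derivative ℂ u) = n * PowerSeries.coeff n u := by
    intro u n
    cases n with
    | zero => simp
    | succ n =>
      rw [PowerSeries.coeff_succ_X_mul, PowerSeries.coeff_derivative]
      push_cast
      ring
  ext1 N
  rw [hsum]
  have hW : PowerSeries.coeff N (PowerSeries.X * adField f g) =
      ∑ p ∈ antidiagonal N, ((p.1 : ℂ) - (p.2 : ℂ)) *
        (PowerSeries.coeff p.1 f * PowerSeries.coeff p.2 g) := by
    have e : PowerSeries.X * adField f g = (PowerSeries.X * PowerSeries.derivative ℂ f) * g -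
        f * (PowerSeries.X * PowerSeries.derivative ℂ g) := by
      simp only [adField, LinearMap.coe_mk, AddHom.coe_mk]; ring
    rw [e, map_sub, PowerSeries.coeff_mul, PowerSeries.coeff_mul, ← Finset.sum_sub_distrib]
    refine Finset.sum_congr rfl fun p _ => ?_
    rw [hX, hX]
    ring
  rw [← hW]
  cases N with
  | zero => simp
  | succ N =>
    rw [PowerSeries.coeff_succ_X_mul, PowerSeries.coeff_succ_X_mul, coeff_modeSeries]
    congr 2
    push_cast
    ring

/-- The commutator of `∑ a_j s^j L(j)` with the operator of a vector field. -/
lemma virSeries_mul_modeSeries {𝒱 : ℤ → Submodule ℂ V} [DirectSum.Decomposition 𝒱]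
    {L : ℤ → Module.End ℂ V} {c : ℂ} (h : IsGradedVirasoroModule 𝒱 L c) (a : ℕ+ → ℂ) (g : ℂ⟦X⟧) :
    virSeries a L * modeSeries L g =
      modeSeries L (adField (fieldSeries a) g) + modeSeries L g * virSeries a L := by
  have h1 := modeSeries_commutator h (fieldSeries a) g
  rw [← X_mul_virSeries, ← mul_assoc, (PowerSeries.commute_X (modeSeries L g)).eq, mul_assoc,
    mul_assoc, ← mul_sub] at h1
  ext1 n
  have h2 := congrArg (PowerSeries.coeff (n + 1)) h1
  rw [PowerSeries.coeff_succ_X_mul, PowerSeries.coeff_succ_X_mul] at h2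
  rw [map_add, ← h2, map_sub, sub_add_cancel]

lemma adicSummable_pow {R : Type*} [Ring R] {S : R⟦X⟧} (hS : PowerSeries.coeff 0 S = 0) :
    AdicSummable fun n => S ^ n := by
  intro n
  induction n with
  | zero => intro m hm; omega
  | succ n ih =>
    intro m hm
    simp only [pow_succ']
    rw [PowerSeries.coeff_mul]
    refine Finset.sum_eq_zero fun p hp => ?_
    have := mem_antidiagonal.1 hp
    by_cases h : p.1 = 0
    · rw [h, hS, zero_mul]
    · rw [ih p.2 (by omega), mul_zero]

lemma coeff_smul_end {m : ℕ} (c : ℂ) (A : PowerSeries (Module.End ℂ V)) :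
    PowerSeries.coeff m (c • A) = c • PowerSeries.coeff m A := rfl

lemma adicSummable_exp {S : PowerSeries (Module.End ℂ V)} (hS : PowerSeries.coeff 0 S = 0) :
    AdicSummable fun n => ((n.factorial : ℂ)⁻¹) • S ^ n := by
  intro n m hm
  rw [coeff_smul_end, adicSummable_pow hS n m hm, smul_zero]

lemma formalExp_eq_seriesSum (S : PowerSeries (Module.End ℂ V)) :
    formalExp S = seriesSum fun n => ((n.factorial : ℂ)⁻¹) • S ^ n := rfl

lemma formalExp_mul_neg {S : PowerSeries (Module.End ℂ V)} (hS : PowerSeries.coeff 0 S = 0) :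
    formalExp S * formalExp (-S) = 1 := by
  have hS' : PowerSeries.coeff 0 (-S) = 0 := by rw [map_neg, hS, neg_zero]
  rw [formalExp_eq_seriesSum, formalExp_eq_seriesSum,
    seriesSum_mul (adicSummable_exp hS) (adicSummable_exp hS')]
  have h : ∀ n : ℕ, (∑ p ∈ antidiagonal n, ((p.1.factorial : ℂ)⁻¹ • S ^ p.1) *
      ((p.2.factorial : ℂ)⁻¹ • (-S) ^ p.2)) = if n = 0 then 1 else 0 := by
    intro n
    -- the operators `u ↦ u S` and `v ↦ -S v` cancel in the product `u v`
    have := divPow_bilin (LinearMap.mul ℂ (PowerSeries (Module.End ℂ V))) 0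
      (LinearMap.mulRight ℂ S) (LinearMap.mulLeft ℂ (-S)) (by
        intro u v
        simp [mul_assoc]) n 1 1
    simp only [divPow, LinearMap.pow_mulLeft, LinearMap.pow_mulRight, LinearMap.smul_apply,
      LinearMap.mulLeft_apply, LinearMap.mulRight_apply, LinearMap.mul_apply', one_mul,
      mul_one] at this
    rw [← this]
    cases n <;> simp
  simp only [h]
  ext1 m
  rw [seriesSum, PowerSeries.coeff_mk, Finset.sum_eq_single 0] <;> simp +contextual

/-- Conjugation by `exp (∑ a_j s^j L(j))` acts on the operators of vector fields through the
adjoint action of `exp (-∑ a_j x^(j+1) d/dx)`. -/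
lemma formalExp_mul_modeSeries {𝒱 : ℤ → Submodule ℂ V} [DirectSum.Decomposition 𝒱]
    {L : ℤ → Module.End ℂ V} {c : ℂ} (h : IsGradedVirasoroModule 𝒱 L c) (a : ℕ+ → ℂ) (g : ℂ⟦X⟧) :
    formalExp (virSeries a L) * modeSeries L g =
      modeSeries L (expAd (fieldSeries a) g) * formalExp (virSeries a L) := by
  have hS : PowerSeries.coeff 0 (virSeries a L) = 0 := by simp [virSeries]
  have hW := adicSummable_adField (X_sq_dvd_fieldSeries a) g
  have hT : AdicSummable fun n => modeSeries L (divPow (adField (fieldSeries a)) n g) := by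
    intro n m hm
    rw [coeff_modeSeries, hW n m hm, zero_smul]
  have hE : modeSeries L (expAd (fieldSeries a) g) =
      seriesSum fun n => modeSeries L (divPow (adField (fieldSeries a)) n g) := by
    ext1 m
    simp only [coeff_modeSeries, expAd, seriesSum, PowerSeries.coeff_mk, Finset.sum_smul]
  rw [hE, formalExp_eq_seriesSum, seriesSum_mul hT (adicSummable_exp hS)]
  have hn : ∀ n : ℕ, (∑ p ∈ antidiagonal n, modeSeries L (divPow (adField (fieldSeries a)) p.1 g) *
      ((p.2.factorial : ℂ)⁻¹ • virSeries a L ^ p.2)) =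
      ((n.factorial : ℂ)⁻¹ • virSeries a L ^ n) * modeSeries L g := by
    intro n
    have := divPow_bilin ((LinearMap.mul ℂ (PowerSeries (Module.End ℂ V))).comp (modeSeries L))
      (LinearMap.mulLeft ℂ (virSeries a L)) (adField (fieldSeries a))
      (LinearMap.mulLeft ℂ (virSeries a L)) (by
        intro u v
        simp only [LinearMap.comp_apply, LinearMap.mul_apply', LinearMap.mulLeft_apply]
        rw [← mul_assoc, virSeries_mul_modeSeries h, add_mul, mul_assoc]) n g 1
    simp only [LinearMap.comp_apply, LinearMap.mul_apply', mul_one] at this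
    simp only [divPow, LinearMap.pow_mulLeft, LinearMap.smul_apply, LinearMap.mulLeft_apply,
      mul_one] at this ⊢
    rw [← this, smul_mul_assoc]
  simp only [hn]
  ext1 m
  rw [PowerSeries.coeff_mul]
  have h1 : ∀ p ∈ antidiagonal m, PowerSeries.coeff p.1
      (seriesSum fun n => ((n.factorial : ℂ)⁻¹) • virSeries a L ^ n) *
        PowerSeries.coeff p.2 (modeSeries L g) = ∑ n ∈ Finset.range (m + 1), PowerSeries.coeff p.1
          (((n.factorial : ℂ)⁻¹) • virSeries a L ^ n) *
          PowerSeries.coeff p.2 (modeSeries L g) := by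
    intro p hp
    have := mem_antidiagonal.1 hp
    rw [coeff_seriesSum (adicSummable_exp hS) (K := m + 1) (by omega), Finset.sum_mul]
  rw [Finset.sum_congr rfl h1, Finset.sum_comm, seriesSum, PowerSeries.coeff_mk]
  exact Finset.sum_congr rfl fun n _ => (PowerSeries.coeff_mul _ _ _).symm

end Modes

/-! ### Gradings and weights -/

section Graded

variable {V : Type*} [AddCommGroup V] [Module ℂ V] (𝒱 : ℤ → Submodule ℂ V)
  [DirectSum.Decomposition 𝒱]

lemma weightScale_apply (f : ℤ → ℂ) {n : ℤ} {v : V} (hv : v ∈ 𝒱 n) :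
    weightScale 𝒱 f v = f n • v := by
  rw [weightScale, LinearMap.comp_apply, LinearEquiv.coe_coe,
    DirectSum.decomposeLinearEquiv_apply, DirectSum.decompose_of_mem 𝒱 hv,
    ← DirectSum.lof_eq_of ℂ, DirectSum.toModule_lof]
  rfl

lemma end_ext {A B : Module.End ℂ V} (h : ∀ n, ∀ v ∈ 𝒱 n, A v = B v) : A = B := by
  ext1 v
  induction v using DirectSum.Decomposition.inductionOn 𝒱 with
  | zero => simp
  | homogeneous v => exact h _ _ v.2
  | add v w hv hw => rw [map_add, map_add, hv, hw]

variable {𝒱}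

lemma mem_of_weight {L : ℤ → Module.End ℂ V} {c : ℂ} (h : IsGradedVirasoroModule 𝒱 L c) {q : ℤ}
    {w : V} (hw : L 0 w = (q : ℂ) • w) : w ∈ 𝒱 q := by
  have hdec : ∀ (v : V) (m : ℤ), (DirectSum.decompose 𝒱 (L 0 v) m : V) =
      (m : ℂ) • (DirectSum.decompose 𝒱 v m : V) := by
    intro v m
    induction v using DirectSum.Decomposition.inductionOn 𝒱 with
    | zero => simp
    | @homogeneous i v =>
      rw [h.weight i v v.2, DirectSum.decompose_smul, DirectSum.smul_apply, Submodule.coe_smul]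
      by_cases hi : i = m
      · subst hi
        rfl
      · rw [DirectSum.decompose_of_mem_ne 𝒱 v.2 hi, smul_zero, smul_zero]
    | add v w hv hw =>
      simp only [map_add, DirectSum.decompose_add, DirectSum.add_apply, Submodule.coe_add, hv, hw,
        smul_add]
  have hz : ∀ m, m ≠ q → (DirectSum.decompose 𝒱 w m : V) = 0 := by
    intro m hm
    have h1 := hdec w m
    rw [hw, DirectSum.decompose_smul, DirectSum.smul_apply, Submodule.coe_smul, ← sub_eq_zero,
      ← sub_smul] at h1
    refine (smul_eq_zero.1 h1).resolve_left (sub_ne_zero.2 ?_)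
    exact_mod_cast hm.symm
  classical
  rw [← DirectSum.sum_support_decompose 𝒱 w]
  refine Submodule.sum_mem _ fun m _ => ?_
  by_cases hm : m = q
  · rw [← hm]; exact SetLike.coe_mem _
  · rw [hz m hm]; exact Submodule.zero_mem _

lemma L_neg_one_mem {L : ℤ → Module.End ℂ V} {c : ℂ} (h : IsGradedVirasoroModule 𝒱 L c) {n : ℤ}
    {v : V} (hv : v ∈ 𝒱 n) : L (-1) v ∈ 𝒱 (n + 1) := by
  refine mem_of_weight h ?_
  have h1 := congrArg (· v) (h.commutator 0 (-1))
  simp [h.weight n v hv] at h1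
  rw [sub_eq_iff_eq_add] at h1
  rw [h1]
  push_cast
  module

/-- The coefficient of `s^N` lowers the weight, that is the eigenvalue of `L(0)`, by `N`. -/
def LowersWeight (L : ℤ → Module.End ℂ V) (A : PowerSeries (Module.End ℂ V)) : Prop :=
  ∀ N : ℕ, L 0 * PowerSeries.coeff N A =
    PowerSeries.coeff N A * L 0 - (N : ℂ) • PowerSeries.coeff N A

lemma LowersWeight.mul {L : ℤ → Module.End ℂ V} {A B : PowerSeries (Module.End ℂ V)}
    (hA : LowersWeight L A) (hB : LowersWeight L B) : LowersWeight L (A * B) := by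
  intro N
  rw [PowerSeries.coeff_mul, Finset.mul_sum, Finset.sum_mul, Finset.smul_sum,
    ← Finset.sum_sub_distrib]
  refine Finset.sum_congr rfl fun p hp => ?_
  rw [← mul_assoc, hA, sub_mul, mul_assoc, hB, ← mem_antidiagonal.1 hp]
  simp only [mul_sub, smul_mul_assoc, mul_smul_comm, Nat.cast_add, add_smul, mul_assoc]
  abel

lemma LowersWeight.pow {L : ℤ → Module.End ℂ V} {A : PowerSeries (Module.End ℂ V)}
    (hA : LowersWeight L A) (n : ℕ) : LowersWeight L (A ^ n) := by
  induction n with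
  | zero =>
    intro N
    rw [pow_zero, PowerSeries.coeff_one]
    split_ifs with h <;> simp [h]
  | succ n ih => rw [pow_succ]; exact ih.mul hA

lemma LowersWeight.neg {L : ℤ → Module.End ℂ V} {A : PowerSeries (Module.End ℂ V)}
    (hA : LowersWeight L A) : LowersWeight L (-A) := by
  intro N
  rw [map_neg, mul_neg, hA, neg_mul, smul_neg]
  abel

lemma LowersWeight.formalExp {L : ℤ → Module.End ℂ V} {A : PowerSeries (Module.End ℂ V)}
    (hA : LowersWeight L A) : LowersWeight L (formalExp A) := by
  intro N
  rw [VirasoroDelta.formalExp, PowerSeries.coeff_mk, Finset.mul_sum, Finset.sum_mul,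
    Finset.smul_sum, ← Finset.sum_sub_distrib]
  refine Finset.sum_congr rfl fun n _ => ?_
  rw [mul_smul_comm, hA.pow n N, smul_sub, smul_mul_assoc, smul_comm]

lemma lowersWeight_virSeries {L : ℤ → Module.End ℂ V} {c : ℂ}
    (h : IsGradedVirasoroModule 𝒱 L c) (a : ℕ+ → ℂ) : LowersWeight L (virSeries a L) := by
  intro N
  rw [virSeries, PowerSeries.coeff_mk]
  split_ifs with hN
  · have h1 : L 0 * L N - L N * L 0 = _ := h.commutator 0 (N : ℤ)
    rw [if_neg (by omega), zero_smul, add_zero, zero_add, sub_eq_iff_eq_add] at h1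
    rw [mul_smul_comm, h1, smul_mul_assoc]
    push_cast
    module
  · simp

/-! ### Coefficients of powers of `z^(-1/k)` -/

lemma atInvRoot_mem {L : ℤ → Module.End ℂ V} {c : ℂ} (h : IsGradedVirasoroModule 𝒱 L c)
    {A : PowerSeries (Module.End ℂ V)} (hA : LowersWeight L A) (i : ℤ) {n : ℤ} {v : V}
    (hv : v ∈ 𝒱 n) : atInvRoot A i v ∈ 𝒱 (n + i) := by
  rw [atInvRoot]
  split_ifs with hi
  · refine mem_of_weight h ?_
    have h1 : L 0 (PowerSeries.coeff (-i).toNat A v) = _ := congrArg (· v) (hA (-i).toNat)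
    have hN : (((-i).toNat : ℕ) : ℂ) = -(i : ℂ) := by
      rw [← Int.cast_natCast, Int.toNat_of_nonneg (by omega), Int.cast_neg]
    rw [h1]
    simp [h.weight n v hv, hN, add_smul]
  · exact Submodule.zero_mem _

lemma atInvRoot_neg (A : PowerSeries (Module.End ℂ V)) (N : ℕ) :
    atInvRoot A (-(N : ℤ)) = PowerSeries.coeff N A := by
  simp [atInvRoot]

lemma atInvRoot_pos (A : PowerSeries (Module.End ℂ V)) {i : ℤ} (h : 0 < i) :
    atInvRoot A i = 0 := by
  simp [atInvRoot, h]

/-- An intertwining relation between vector fields `(1 + p x) d/dx` and `(1 + q x) d/dx`, in terms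
of the coefficients of the intertwining series. -/
lemma atInvRoot_relation {L : ℤ → Module.End ℂ V} {A : PowerSeries (Module.End ℂ V)} {p q : ℂ}
    (h : A * modeSeries L (1 + PowerSeries.C p * PowerSeries.X) =
      modeSeries L (1 + PowerSeries.C q * PowerSeries.X) * A) (i : ℤ) (v : V) :
    atInvRoot A i (L (-1) v) + p • atInvRoot A (i + 1) (L 0 v) =
      L (-1) (atInvRoot A i v) + q • L 0 (atInvRoot A (i + 1) v) := by
  have hT : ∀ r : ℂ, modeSeries L (1 + PowerSeries.C r * PowerSeries.X) =
      PowerSeries.C (L (-1)) + PowerSeries.C (r • L 0) * PowerSeries.X := by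
    intro r
    ext1 n
    rw [coeff_modeSeries]
    rcases n with _ | _ | n
    · simp
    · simp [PowerSeries.coeff_succ_mul_X, PowerSeries.coeff_one, PowerSeries.coeff_C]
    · simp [PowerSeries.coeff_succ_mul_X, PowerSeries.coeff_one]
  rw [hT, hT, mul_add, add_mul, ← mul_assoc, mul_assoc _ PowerSeries.X,
    ← (PowerSeries.commute_X A).eq, ← mul_assoc] at h
  obtain hi | rfl | hi : 0 < i ∨ i = 0 ∨ i < 0 := by omega
  · simp [atInvRoot_pos A hi, atInvRoot_pos A (show 0 < i + 1 by omega)]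
  · have h1 := congrArg (fun B : PowerSeries (Module.End ℂ V) => PowerSeries.coeff 0 B v) h
    simp at h1
    have h2 := atInvRoot_neg A 0
    simp at h2
    simp [atInvRoot_pos A zero_lt_one, h1, h2]
  · obtain ⟨N, rfl⟩ : ∃ N : ℕ, i = -((N + 1 : ℕ) : ℤ) := ⟨(-i - 1).toNat, by omega⟩
    have h1 := congrArg (fun B : PowerSeries (Module.End ℂ V) => PowerSeries.coeff (N + 1) B v) h
    rw [show -((N + 1 : ℕ) : ℤ) + 1 = -(N : ℤ) by push_cast; ring, atInvRoot_neg, atInvRoot_neg]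
    simpa [PowerSeries.coeff_succ_mul_X, PowerSeries.coeff_mul_C, PowerSeries.coeff_C_mul] using h1

lemma finite_support_atInvRoot (A B : PowerSeries (Module.End ℂ V)) (m : ℤ) (v : V) :
    (Function.support fun i : ℤ => atInvRoot A (m - i) (atInvRoot B i v)).Finite := by
  refine (Set.finite_Icc m 0).subset fun i hi => ?_
  by_contra hcon
  refine hi ?_
  simp only [Set.mem_Icc, not_and_or, not_le] at hcon
  rcases hcon with hcon | hcon
  · simp [atInvRoot_pos A (show 0 < m - i by omega)]
  · simp [atInvRoot_pos B hcon]

lemma finsum_atInvRoot {A B : PowerSeries (Module.End ℂ V)} (h : A * B = 1) (m : ℤ) (v : V) :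
    ∑ᶠ i : ℤ, atInvRoot A (m - i) (atInvRoot B i v) = if m = 0 then v else 0 := by
  by_cases hm : 0 < m
  · rw [if_neg hm.ne']
    refine finsum_eq_zero_of_forall_eq_zero fun i => ?_
    by_cases hi : 0 < i
    · simp [atInvRoot_pos B hi]
    · simp [atInvRoot_pos A (show 0 < m - i by omega)]
  · obtain ⟨N, rfl⟩ : ∃ N : ℕ, m = -(N : ℤ) := ⟨(-m).toNat, by omega⟩
    have h1 := congrArg (fun B : PowerSeries (Module.End ℂ V) => PowerSeries.coeff N B v) h
    simp only [PowerSeries.coeff_mul, PowerSeries.coeff_one, LinearMap.sum_apply,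
      Module.End.mul_apply] at h1
    have h2 : (∑ᶠ i : ℤ, atInvRoot A (-(N : ℤ) - i) (atInvRoot B i v)) =
        ∑ p ∈ antidiagonal N, PowerSeries.coeff p.1 A (PowerSeries.coeff p.2 B v) := by
      have hsub : (Function.support fun i : ℤ => atInvRoot A (-(N : ℤ) - i) (atInvRoot B i v)) ⊆
          ((antidiagonal N).image fun p => -(p.2 : ℤ) : Finset ℤ) := by
        intro i hi
        by_contra hcon
        refine hi ?_
        by_cases h0 : 0 < i
        · simp [atInvRoot_pos B h0]
        · by_cases h3 : 0 < -(N : ℤ) - i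
          · simp [atInvRoot_pos A h3]
          · refine absurd ?_ hcon
            simp only [Finset.coe_image, Set.mem_image, Finset.mem_coe, mem_antidiagonal]
            exact ⟨(((N : ℤ) + i).toNat, (-i).toNat), by simp; omega, by simp; omega⟩
      rw [finsum_eq_sum_of_support_subset _ hsub, Finset.sum_image]
      · refine Finset.sum_congr rfl fun p hp => ?_
        rw [← atInvRoot_neg A, ← atInvRoot_neg B,
          show -(N : ℤ) - -(p.2 : ℤ) = -(p.1 : ℤ) by rw [← mem_antidiagonal.1 hp]; push_cast; ring]
      · intro p hp q hq hpq
        have hp' := mem_antidiagonal.1 hp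
        have hq' := mem_antidiagonal.1 hq
        ext <;> simp at hpq <;> omega
    rw [h2, h1]
    by_cases hN : N = 0 <;> simp [hN]

end Graded

/-! ### The operator `Δ_k(z)` and its inverse -/

section Delta

lemma finsum_comp_of_support_subset_range {ι κ M : Type*} [AddCommMonoid M] {f : ι → M}
    {e : κ → ι} (he : Function.Injective e) (hf : Function.support f ⊆ Set.range e) :
    ∑ᶠ j, f (e j) = ∑ᶠ i, f i := by
  rw [← finsum_mem_range he, finsum_mem_def, Set.indicator_eq_self.2 hf]

lemma finite_support_of_comp {ι κ M : Type*} [Zero M] {f : ι → M} {e : κ → ι}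
    (hf : Function.support f ⊆ Set.range e) (h : (Function.support fun j => f (e j)).Finite) :
    (Function.support f).Finite := by
  refine (h.image e).subset fun i hi => ?_
  obtain ⟨j, rfl⟩ := hf hi
  exact ⟨j, hi, rfl⟩

open EndSeries

variable {V : Type*} [AddCommGroup V] [Module ℂ V] {𝒱 : ℤ → Submodule ℂ V}
  [DirectSum.Decomposition 𝒱]

variable (𝒱) in
lemma prodExists_of_homogeneous {A B : EndSeries V} (h : ∀ m n : ℤ, ∀ v ∈ 𝒱 n,
    (Function.support fun i : ℤ => A i (B (m - i) v)).Finite) : ProdExists A B := by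
  intro m v
  induction v using DirectSum.Decomposition.inductionOn 𝒱 with
  | zero => simp
  | homogeneous v => exact h m _ v v.2
  | add v w hv hw =>
    simp only [map_add]
    exact (hv.union hw).subset (Function.support_add _ _)

lemma prod_apply {A B : EndSeries V} (h : ProdExists A B) (m : ℤ) (v : V) :
    prod A B m v = ∑ᶠ i : ℤ, A i (B (m - i) v) := by
  rw [prod, dif_pos h]
  rfl

variable (𝒱) in
lemma endSeries_ext {A B : EndSeries V} (h : ∀ m n : ℤ, ∀ v ∈ 𝒱 n, A m v = B m v) : A = B :=
  funext fun m => end_ext 𝒱 (h m)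

variable (k : ℕ+) {L : ℤ → Module.End ℂ V} {c : ℂ}

lemma scaling_apply (m : ℤ) {n : ℤ} {v : V} (hv : v ∈ 𝒱 n) :
    scaling 𝒱 k m v = if (1 - (k : ℕ)) * n = m then ((k : ℕ) : ℂ) ^ (-n) • v else 0 := by
  rw [scaling, opMul, LinearMap.comp_apply, zPow, weightScale_apply 𝒱 _ hv, map_smul, kPow,
    weightScale_apply 𝒱 _ hv, neg_one_mul]
  split_ifs <;> simp

lemma scalingInv_apply (m : ℤ) {n : ℤ} {v : V} (hv : v ∈ 𝒱 n) :
    scalingInv 𝒱 k m v = if ((k : ℕ) - 1) * n = m then ((k : ℕ) : ℂ) ^ n • v else 0 := by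
  rw [scalingInv, mulOp, LinearMap.comp_apply, kPow, weightScale_apply 𝒱 _ hv, map_smul, zPow,
    weightScale_apply 𝒱 _ hv, one_mul, neg_sub]
  split_ifs <;> simp

variable (𝒱) (L) in
lemma prodExists_expL_scaling : ProdExists (expL k L) (scaling 𝒱 k) := by
  refine prodExists_of_homogeneous 𝒱 fun m n v hv => ?_
  refine (Set.finite_singleton (m - (1 - (k : ℕ)) * n)).subset fun i hi => ?_
  by_contra hcon
  refine hi ?_
  rw [Set.mem_singleton_iff] at hcon
  simp only [scaling_apply k _ hv]
  rw [if_neg (by intro h0; apply hcon; rw [h0]; ring), map_zero]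

lemma Delta_apply (m : ℤ) {n : ℤ} {v : V} (hv : v ∈ 𝒱 n) :
    Delta 𝒱 k L m v = ((k : ℕ) : ℂ) ^ (-n) • expL k L (m + ((k : ℕ) - 1) * n) v := by
  rw [Delta, prod_apply (prodExists_expL_scaling 𝒱 k L),
    finsum_eq_single _ (m + ((k : ℕ) - 1) * n)]
  · rw [scaling_apply k _ hv, if_pos (by ring), map_smul]
  · intro i hi
    rw [scaling_apply k _ hv, if_neg (by intro h0; apply hi; linear_combination h0), map_zero]

lemma lowersWeight_expNeg (h : IsGradedVirasoroModule 𝒱 L c) :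
    LowersWeight L (formalExp (-virSeries (aCoeff k) L)) :=
  (lowersWeight_virSeries h _).neg.formalExp

lemma scalingInv_expNegL (h : IsGradedVirasoroModule 𝒱 L c) (m i : ℤ) {n : ℤ} {v : V}
    (hv : v ∈ 𝒱 n) : scalingInv 𝒱 k i (expNegL k L (m - i) v) =
      if ((k : ℕ) - 1) * (n + (m - i)) = i then
        ((k : ℕ) : ℂ) ^ (n + (m - i)) • expNegL k L (m - i) v else 0 :=
  scalingInv_apply k i (atInvRoot_mem h (lowersWeight_expNeg k h) (m - i) hv)

lemma prodExists_scalingInv_expNegL (h : IsGradedVirasoroModule 𝒱 L c) :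
    ProdExists (scalingInv 𝒱 k) (expNegL k L) := by
  have hk : ((k : ℕ) : ℤ) ≠ 0 := by exact_mod_cast k.ne_zero
  refine prodExists_of_homogeneous 𝒱 fun m n v hv => ?_
  -- the index `i` of a nonzero term is determined by `k i = (k - 1) (n + m)`
  refine Set.Subsingleton.finite fun i hi j hj => ?_
  simp only [Function.mem_support, scalingInv_expNegL k h m _ hv, ne_eq, ite_eq_right_iff,
    Classical.not_imp] at hi hj
  refine mul_left_cancel₀ hk ?_
  linear_combination hj.1 - hi.1

lemma DeltaInv_apply (h : IsGradedVirasoroModule 𝒱 L c) (M : ℤ) {n : ℤ} {v : V} (hv : v ∈ 𝒱 n) :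
    DeltaInv 𝒱 k L ((k : ℕ) * M - n) v = ((k : ℕ) : ℂ) ^ M • expNegL k L (M - n) v := by
  have hk : ((k : ℕ) : ℤ) ≠ 0 := by exact_mod_cast k.ne_zero
  rw [DeltaInv, prod_apply (prodExists_scalingInv_expNegL k h),
    finsum_eq_single _ (((k : ℕ) - 1) * M)]
  · have e : ((k : ℕ) * M - n - ((k : ℕ) - 1) * M : ℤ) = M - n := by ring
    rw [scalingInv_expNegL k h _ _ hv, e, if_pos (by ring), add_sub_cancel]
  · intro i hi
    rw [scalingInv_expNegL k h _ _ hv, if_neg]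
    intro h0
    refine hi (mul_left_cancel₀ hk ?_)
    linear_combination -h0

lemma DeltaInv_apply_of_not_dvd (h : IsGradedVirasoroModule 𝒱 L c) {m n : ℤ} {v : V}
    (hv : v ∈ 𝒱 n) (hm : ¬ ((k : ℕ) : ℤ) ∣ m + n) : DeltaInv 𝒱 k L m v = 0 := by
  rw [DeltaInv, prod_apply (prodExists_scalingInv_expNegL k h)]
  refine finsum_eq_zero_of_forall_eq_zero fun i => ?_
  rw [scalingInv_expNegL k h _ _ hv, if_neg]
  intro h0
  exact hm ⟨n + m - i, by linear_combination -h0⟩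

lemma Delta_mem (h : IsGradedVirasoroModule 𝒱 L c) (m : ℤ) {n : ℤ} {v : V} (hv : v ∈ 𝒱 n) :
    Delta 𝒱 k L m v ∈ 𝒱 (m + (k : ℕ) * n) := by
  rw [Delta_apply k m hv, show m + (k : ℕ) * n = n + (m + ((k : ℕ) - 1) * n) by ring]
  exact Submodule.smul_mem _ _
    (atInvRoot_mem h (lowersWeight_virSeries h _).formalExp _ hv)

lemma coeff_zero_virSeries (a : ℕ+ → ℂ) (L : ℤ → Module.End ℂ V) :
    PowerSeries.coeff 0 (virSeries a L) = 0 := by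
  simp [virSeries]

variable (L) in
lemma expPos_mul_expNeg : formalExp (virSeries (aCoeff k) L) *
    formalExp (-virSeries (aCoeff k) L) = 1 :=
  formalExp_mul_neg (coeff_zero_virSeries _ L)

variable (L) in
lemma expNeg_mul_expPos : formalExp (-virSeries (aCoeff k) L) *
    formalExp (virSeries (aCoeff k) L) = 1 := by
  have := formalExp_mul_neg (S := -virSeries (aCoeff k) L)
    (by rw [map_neg, coeff_zero_virSeries, neg_zero])
  rwa [neg_neg] at this

/-- The nonzero terms of the coefficients of `Δ_k(z) Δ_k(z)⁻¹` are those of the coefficients of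
`exp(S) exp(-S)`. -/
lemma Delta_DeltaInv_terms (h : IsGradedVirasoroModule 𝒱 L c) (m : ℤ) {n : ℤ} {v : V}
    (hv : v ∈ 𝒱 n) :
    (Function.support fun i : ℤ => Delta 𝒱 k L i (DeltaInv 𝒱 k L (m - i) v)) ⊆
        Set.range (fun N : ℤ => m - (k : ℕ) * (N + n) + n) ∧
      ∀ N : ℤ, Delta 𝒱 k L (m - (k : ℕ) * (N + n) + n)
          (DeltaInv 𝒱 k L (m - (m - (k : ℕ) * (N + n) + n)) v) =
        expL k L (m - N) (expNegL k L N v) := by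
  have hk : ((k : ℕ) : ℂ) ≠ 0 := by exact_mod_cast k.ne_zero
  constructor
  · intro i hi
    by_contra hcon
    refine hi ?_
    beta_reduce
    rw [DeltaInv_apply_of_not_dvd k h hv, map_zero]
    rintro ⟨M, hM⟩
    exact hcon ⟨M - n, by simp only; linear_combination hM⟩
  · intro N
    have hw : expNegL k L N v ∈ 𝒱 (n + N) := atInvRoot_mem h (lowersWeight_expNeg k h) N hv
    rw [show m - (m - (k : ℕ) * (N + n) + n) = (k : ℕ) * (N + n) - n by ring,
      DeltaInv_apply k h _ hv, add_sub_cancel_right, map_smul, Delta_apply k _ hw, smul_smul,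
      ← zpow_add₀ hk, show N + n + -(n + N) = 0 by ring, zpow_zero, one_smul]
    congr 2
    ring

/-- The terms of the coefficient of `z^M` in `Δ_k(z)⁻¹ Δ_k(z)` are `k^M` times those of the
coefficient of `s^(-M)` in `exp(-S) exp(S)`. -/
lemma DeltaInv_Delta_term (h : IsGradedVirasoroModule 𝒱 L c) (M N : ℤ) {n : ℤ} {v : V}
    (hv : v ∈ 𝒱 n) :
    DeltaInv 𝒱 k L ((k : ℕ) * M - N + ((k : ℕ) - 1) * n)
        (Delta 𝒱 k L ((k : ℕ) * M - ((k : ℕ) * M - N + ((k : ℕ) - 1) * n)) v) =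
      ((k : ℕ) : ℂ) ^ M • expNegL k L (M - N) (expL k L N v) := by
  have hk : ((k : ℕ) : ℂ) ≠ 0 := by exact_mod_cast k.ne_zero
  have hw : expL k L N v ∈ 𝒱 (n + N) :=
    atInvRoot_mem h (lowersWeight_virSeries h _).formalExp N hv
  rw [Delta_apply k _ hv, map_smul,
    show (k : ℕ) * M - ((k : ℕ) * M - N + ((k : ℕ) - 1) * n) + ((k : ℕ) - 1) * n = N by ring,
    show (k : ℕ) * M - N + ((k : ℕ) - 1) * n = (k : ℕ) * (M + n) - (n + N) by ring,
    DeltaInv_apply k h _ hw, smul_smul, ← zpow_add₀ hk]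
  congr 2
  · ring
  · congr 1
    ring

/-- Only integral powers of `z` occur in `Δ_k(z)⁻¹ Δ_k(z)`. -/
lemma DeltaInv_Delta_term_of_not_dvd (h : IsGradedVirasoroModule 𝒱 L c) {m : ℤ} (i : ℤ) {n : ℤ}
    {v : V} (hv : v ∈ 𝒱 n) (hm : ¬ ((k : ℕ) : ℤ) ∣ m) :
    DeltaInv 𝒱 k L i (Delta 𝒱 k L (m - i) v) = 0 := by
  refine DeltaInv_apply_of_not_dvd k h (Delta_mem k h _ hv) ?_
  rw [show i + (m - i + (k : ℕ) * n) = m + (k : ℕ) * n by ring]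
  exact fun hd => hm ((dvd_add_left (dvd_mul_right _ _)).1 hd)

lemma one_apply (m : ℤ) (v : V) : (EndSeries.one : EndSeries V) m v = if m = 0 then v else 0 := by
  rw [EndSeries.one]
  split_ifs <;> rfl

lemma isInverse_Delta (h : IsGradedVirasoroModule 𝒱 L c) :
    IsInverse (Delta 𝒱 k L) (DeltaInv 𝒱 k L) := by
  have hk : ((k : ℕ) : ℤ) ≠ 0 := by exact_mod_cast k.ne_zero
  have hex : ProdExists (Delta 𝒱 k L) (DeltaInv 𝒱 k L) := by
    refine prodExists_of_homogeneous 𝒱 fun m n v hv => ?_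
    obtain ⟨hr, ht⟩ := Delta_DeltaInv_terms k h m hv
    refine finite_support_of_comp hr ?_
    simp only [ht]
    exact finite_support_atInvRoot _ _ m v
  have hsurj : ∀ M n : ℤ, Function.Bijective fun N : ℤ => (k : ℕ) * M - N + ((k : ℕ) - 1) * n := by
    intro M n
    refine ⟨fun N N' hN => ?_, fun i => ⟨(k : ℕ) * M - i + ((k : ℕ) - 1) * n, ?_⟩⟩
    · simp only at hN
      linear_combination -hN
    · simp only
      ring
  have hex' : ProdExists (DeltaInv 𝒱 k L) (Delta 𝒱 k L) := by
    refine prodExists_of_homogeneous 𝒱 fun m n v hv => ?_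
    by_cases hm : ((k : ℕ) : ℤ) ∣ m
    · obtain ⟨M, rfl⟩ := hm
      refine finite_support_of_comp (e := fun N : ℤ => (k : ℕ) * M - N + ((k : ℕ) - 1) * n) ?_ ?_
      · rw [(hsurj M n).2.range_eq]
        exact Set.subset_univ _
      · simp only [DeltaInv_Delta_term k h M _ hv]
        exact (finite_support_atInvRoot _ _ M v).subset (Function.support_const_smul_subset _ _)
    · simp [DeltaInv_Delta_term_of_not_dvd k h _ hv hm]
  refine ⟨hex, endSeries_ext 𝒱 fun m n v hv => ?_, hex', endSeries_ext 𝒱 fun m n v hv => ?_⟩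
  · obtain ⟨hr, ht⟩ := Delta_DeltaInv_terms k h m hv
    rw [prod_apply hex, one_apply, ← finsum_comp_of_support_subset_range (fun N N' hN => ?_) hr]
    · simp only [ht]
      exact finsum_atInvRoot (expPos_mul_expNeg k L) m v
    · refine mul_left_cancel₀ hk ?_
      have hN' : m - (k : ℕ) * (N + n) + n = m - (k : ℕ) * (N' + n) + n := hN
      linear_combination -hN'
  · rw [prod_apply hex', one_apply]
    by_cases hm : ((k : ℕ) : ℤ) ∣ m
    · obtain ⟨M, rfl⟩ := hm
      rw [← finsum_comp_of_support_subset_range (hsurj M n).1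
        (by rw [(hsurj M n).2.range_eq]; exact Set.subset_univ _)]
      simp only [DeltaInv_Delta_term k h M _ hv]
      rw [expL, expNegL, ← smul_finsum' _ (finite_support_atInvRoot _ _ M v),
        finsum_atInvRoot (expNeg_mul_expPos k L) M v]
      by_cases hM : M = 0 <;> simp [hM]
    · simp only [DeltaInv_Delta_term_of_not_dvd k h _ hv hm, finsum_zero]
      rw [if_neg (by rintro rfl; exact hm (dvd_zero _))]

/-- The relation `exp(S) (L(-1) + k s L(0)) = (L(-1) + s L(0)) exp(S)`. -/
lemma expPos_intertwines (h : IsGradedVirasoroModule 𝒱 L c) :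
    formalExp (virSeries (aCoeff k) L) *
        modeSeries L (1 + PowerSeries.C ((k : ℕ) : ℂ) * PowerSeries.X) =
      modeSeries L (1 + PowerSeries.C 1 * PowerSeries.X) *
        formalExp (virSeries (aCoeff k) L) := by
  rw [formalExp_mul_modeSeries h, expAd_one_add, map_one, one_mul]

lemma expNeg_intertwines (h : IsGradedVirasoroModule 𝒱 L c) :
    formalExp (-virSeries (aCoeff k) L) *
        modeSeries L (1 + PowerSeries.C 1 * PowerSeries.X) =
      modeSeries L (1 + PowerSeries.C ((k : ℕ) : ℂ) * PowerSeries.X) *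
        formalExp (-virSeries (aCoeff k) L) := by
  have h1 := congrArg (fun B => formalExp (-virSeries (aCoeff k) L) * B *
    formalExp (-virSeries (aCoeff k) L)) (expPos_intertwines k h)
  simp only [← mul_assoc, expNeg_mul_expPos, one_mul] at h1
  rw [h1, mul_assoc, expPos_mul_expNeg, mul_one]

/-- The coefficients of `expPos_intertwines` on a homogeneous vector. -/
lemma expL_relation (h : IsGradedVirasoroModule 𝒱 L c) (i : ℤ) {n : ℤ} {v : V} (hv : v ∈ 𝒱 n) :
    expL k L i (L (-1) v) + (((k : ℕ) : ℂ) * n) • expL k L (i + 1) v =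
      L (-1) (expL k L i v) + ((n : ℂ) + i + 1) • expL k L (i + 1) v := by
  have h1 := atInvRoot_relation (expPos_intertwines k h) i v
  have hw := h.weight _ _
    (atInvRoot_mem h (lowersWeight_virSeries h (aCoeff k)).formalExp (i + 1) hv)
  rw [h.weight n v hv, map_smul, smul_smul, one_smul, hw] at h1
  rw [expL, h1]
  push_cast
  module

/-- The coefficients of `expNeg_intertwines` on a homogeneous vector. -/
lemma expNegL_relation (h : IsGradedVirasoroModule 𝒱 L c) (i : ℤ) {n : ℤ} {v : V}
    (hv : v ∈ 𝒱 n) :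
    expNegL k L i (L (-1) v) + (n : ℂ) • expNegL k L (i + 1) v =
      L (-1) (expNegL k L i v) +
        (((k : ℕ) : ℂ) * ((n : ℂ) + i + 1)) • expNegL k L (i + 1) v := by
  have h1 := atInvRoot_relation (expNeg_intertwines k h) i v
  have hw := h.weight _ _ (atInvRoot_mem h (lowersWeight_expNeg k h) (i + 1) hv)
  rw [h.weight n v hv, map_smul, one_smul, hw] at h1
  rw [expNegL, h1]
  push_cast
  module

lemma Delta_derivative (h : IsGradedVirasoroModule 𝒱 L c) :
    mulOp (Delta 𝒱 k L) (L (-1)) -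
        (1 / ((k : ℕ) : ℂ)) • zMul (1 - (k : ℕ)) (opMul (L (-1)) (Delta 𝒱 k L)) =
      zDeriv k (Delta 𝒱 k L) := by
  have hk : ((k : ℕ) : ℂ) ≠ 0 := by exact_mod_cast k.ne_zero
  refine endSeries_ext 𝒱 fun m n v hv => ?_
  change Delta 𝒱 k L m (L (-1) v) -
      (1 / ((k : ℕ) : ℂ)) • L (-1) (Delta 𝒱 k L (m - (1 - (k : ℕ))) v) =
    (((m + (k : ℕ) : ℤ) : ℂ) / ((k : ℕ) : ℂ)) • Delta 𝒱 k L (m + (k : ℕ)) v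
  rw [Delta_apply k _ (L_neg_one_mem h hv), Delta_apply k _ hv, Delta_apply k _ hv, map_smul]
  have h1 := expL_relation k h (m + ((k : ℕ) - 1) * (n + 1)) hv
  rw [← eq_sub_iff_add_eq] at h1
  rw [h1, show m - (1 - (k : ℕ)) + ((k : ℕ) - 1) * n = m + ((k : ℕ) - 1) * (n + 1) by ring,
    show m + (k : ℕ) + ((k : ℕ) - 1) * n = m + ((k : ℕ) - 1) * (n + 1) + 1 by ring,
    neg_add, zpow_add₀ hk, zpow_neg_one]
  push_cast
  module

lemma DeltaInv_derivative (h : IsGradedVirasoroModule 𝒱 L c) :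
    mulOp (DeltaInv 𝒱 k L) (L (-1)) -
        ((k : ℕ) : ℂ) • zMul (-1 + (k : ℕ)) (opMul (L (-1)) (DeltaInv 𝒱 k L)) =
      ((k : ℕ) : ℂ) • zMul (-1 + (k : ℕ)) (zDeriv k (DeltaInv 𝒱 k L)) := by
  have hk : ((k : ℕ) : ℂ) ≠ 0 := by exact_mod_cast k.ne_zero
  refine endSeries_ext 𝒱 fun m n v hv => ?_
  change DeltaInv 𝒱 k L m (L (-1) v) -
      ((k : ℕ) : ℂ) • L (-1) (DeltaInv 𝒱 k L (m - (-1 + (k : ℕ))) v) =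
    ((k : ℕ) : ℂ) • (((m - (-1 + (k : ℕ)) + (k : ℕ) : ℤ) : ℂ) / ((k : ℕ) : ℂ)) •
      DeltaInv 𝒱 k L (m - (-1 + (k : ℕ)) + (k : ℕ)) v
  have hL := L_neg_one_mem h hv
  rw [smul_smul, mul_div_cancel₀ _ hk, show m - (-1 + (k : ℕ)) + (k : ℕ) = m + 1 by ring]
  by_cases hm : ((k : ℕ) : ℤ) ∣ m + (n + 1)
  · obtain ⟨M, hM⟩ := hm
    obtain rfl : m = (k : ℕ) * M - (n + 1) := by linear_combination hM
    rw [DeltaInv_apply k h _ hL,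
      show (k : ℕ) * M - (n + 1) - (-1 + (k : ℕ)) = (k : ℕ) * (M - 1) - n by ring,
      show (k : ℕ) * M - (n + 1) + 1 = (k : ℕ) * M - n by ring,
      DeltaInv_apply k h _ hv, DeltaInv_apply k h _ hv, map_smul, smul_smul,
      ← zpow_one_add₀ hk, add_sub_cancel]
    have h1 := expNegL_relation k h (M - (n + 1)) hv
    rw [← eq_sub_iff_add_eq] at h1
    rw [h1, show M - 1 - n = M - (n + 1) by ring, show M - (n + 1) + 1 = M - n by ring]
    push_cast
    module
  · rw [DeltaInv_apply_of_not_dvd k h hL hm, DeltaInv_apply_of_not_dvd k h hv,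
      DeltaInv_apply_of_not_dvd k h hv, map_zero, smul_zero, smul_zero, sub_zero]
    · rwa [show m + 1 + n = m + (n + 1) by ring]
    · rw [show m - (-1 + (k : ℕ)) + n = m + (n + 1) - (k : ℕ) by ring]
      exact fun hd => hm ((dvd_sub_left dvd_rfl).1 hd)

theorem Delta_properties (h : IsGradedVirasoroModule 𝒱 L c) :
    (ProdExists (expL k L) (scaling 𝒱 k) ∧ ProdExists (scalingInv 𝒱 k) (expNegL k L) ∧
        IsInverse (Delta 𝒱 k L) (DeltaInv 𝒱 k L)) ∧
      mulOp (Delta 𝒱 k L) (L (-1)) -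
          (1 / ((k : ℕ) : ℂ)) • zMul (1 - (k : ℕ)) (opMul (L (-1)) (Delta 𝒱 k L)) =
        zDeriv k (Delta 𝒱 k L) ∧
      mulOp (DeltaInv 𝒱 k L) (L (-1)) -
          ((k : ℕ) : ℂ) • zMul (-1 + (k : ℕ)) (opMul (L (-1)) (DeltaInv 𝒱 k L)) =
        ((k : ℕ) : ℂ) • zMul (-1 + (k : ℕ)) (zDeriv k (DeltaInv 𝒱 k L)) :=
  ⟨⟨prodExists_expL_scaling 𝒱 k L, prodExists_scalingInv_expNegL k h, isInverse_Delta k h⟩,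
    Delta_derivative k h, DeltaInv_derivative k h⟩

end Delta

end VirasoroDelta

end

open VirasoroDelta EndSeries in
theorem corollary2p5 (k : ℕ+) :
    -- all graded Virasoro modules
    (∀ (V : Type*) [AddCommGroup V] [Module ℂ V] (𝒱 : ℤ → Submodule ℂ V)
      [DirectSum.Decomposition 𝒱] (L : ℤ → Module.End ℂ V) (c : ℂ),
      IsGradedVirasoroModule 𝒱 L c →
        (ProdExists (expL k L) (scaling 𝒱 k) ∧ ProdExists (scalingInv 𝒱 k) (expNegL k L) ∧
          IsInverse (Delta 𝒱 k L) (DeltaInv 𝒱 k L)) ∧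
        mulOp (Delta 𝒱 k L) (L (-1)) -
            (1 / ((k : ℕ) : ℂ)) • zMul (1 - (k : ℕ)) (opMul (L (-1)) (Delta 𝒱 k L)) =
          zDeriv k (Delta 𝒱 k L) ∧
        mulOp (DeltaInv 𝒱 k L) (L (-1)) -
            ((k : ℕ) : ℂ) • zMul (-1 + (k : ℕ)) (opMul (L (-1)) (DeltaInv 𝒱 k L)) =
          ((k : ℕ) : ℂ) • zMul (-1 + (k : ℕ)) (zDeriv k (DeltaInv 𝒱 k L))) ∧
    -- in particular, all vertex operator algebras
    (∀ (V : Type*) [AddCommGroup V] [Module ℂ V] (𝒱 : ℤ → Submodule ℂ V)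
      [DirectSum.Decomposition 𝒱] (A : VertexOperatorAlgebra 𝒱),
        (ProdExists (expL k A.L) (scaling 𝒱 k) ∧ ProdExists (scalingInv 𝒱 k) (expNegL k A.L) ∧
          IsInverse (Delta 𝒱 k A.L) (DeltaInv 𝒱 k A.L)) ∧
        mulOp (Delta 𝒱 k A.L) (A.L (-1)) -
            (1 / ((k : ℕ) : ℂ)) • zMul (1 - (k : ℕ)) (opMul (A.L (-1)) (Delta 𝒱 k A.L)) =
          zDeriv k (Delta 𝒱 k A.L) ∧
        mulOp (DeltaInv 𝒱 k A.L) (A.L (-1)) -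
            ((k : ℕ) : ℂ) • zMul (-1 + (k : ℕ)) (opMul (A.L (-1)) (DeltaInv 𝒱 k A.L)) =
          ((k : ℕ) : ℂ) • zMul (-1 + (k : ℕ)) (zDeriv k (DeltaInv 𝒱 k A.L))) := by
  exact ⟨fun V _ _ 𝒱 _ L c h => Delta_properties k h,
    fun V _ _ 𝒱 _ A => Delta_properties k (L := A.L) A.virasoro⟩
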